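/- Let $\ell\in\tfrac12\mathbb N=\{0,\tfrac12,1,\tfrac32,\dots\}$, let $(a)_k=a(a+1)\cdots(a+k-1)$, and let $U_k$ be the Chebyshev polynomials of the second kind. Let $W(x)=(W(x)_{n,m})_{n,m=0}^{2\ell}$, $x\in[-1,1]$, be the symmetric $(2\ell+1)\times(2\ell+1)$ matrix weight given for $m\le n$ by $$W(x)_{n,m}=\sqrt{1-x^2}\,\sum_{t=0}^m \alpha_t(m,n)\,U_{n+m-2t}(x),$$ $$\alpha_t(m,n)=\frac{2\ell+1}{n+1}\,\frac{(2\ell-m)!\,m!}{(2\ell)!}\,(-1)^{m-t}\,\frac{(n-2\ell)_{m-t}}{(n+2)_{m-t}}\,\frac{(2\ell+2-t)_t}{t!},$$ and by $W(x)_{n,m}=W(x)_{m,n}$ for $n<m$. Put $\langle P,Q\rangle_W=\int_{-1}^1 P(x)W(x)Q(x)^*\,dx$ for polynomials $P,Q$ with coefficients in $M_{2\ell+1}(\mathbb C)$. There is a unique sequence $(P_n)_{n\ge0}$ of such polynomials with $P_n$ monic of degree $n$ (leading coefficient the identity matrix) and $\langle P_n,P_m\rangle_W=0$ for $n\ne m$.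 For every $n\ge 0$ the squared norm matrix $H_n=\langle P_n,P_n\rangle_W$ is diagonal: for $0\le i,j\le 2\ell$, $$(H_n)_{ij}=\delta_{ij}\,\frac{\pi}{2}\,\frac{(n!)^2\,\big((2\ell+1)_{n+1}\big)^2}{\big((i+1)_n\big)^2\,\big((2\ell-i+1)_n\big)^2}\,\frac{2^{-2n}}{(n+i+1)(2\ell-i+n+1)}.$$ Moreover $JH_nJ=H_n$, where $J\in M_{2\ell+1}(\mathbb C)$ is given by $J_{nm}=\delta_{n+m,2\ell}$, $0\le n,m\le 2\ell$. -/

import Mathlib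

open scoped Matrix

noncomputable section

/-- The shifted factorial (Pochhammer symbol) `(a)_k = a (a + 1) ⋯ (a + k - 1)`. -/
def shiftedFactorial (a : ℝ) (k : ℕ) : ℝ :=
  (ascPochhammer ℝ k).eval a

/-- The coefficients `α_t(m,n)` of the weight, where `N = 2ℓ` (used for `t ≤ m ≤ n ≤ N`). -/
def weightCoeff (N t m n : ℕ) : ℝ :=
  ((N : ℝ) + 1) / ((n : ℝ) + 1)
    * (((N - m).factorial : ℝ) * (m.factorial : ℝ) / (N.factorial : ℝ))
    * (-1) ^ (m - t)
    * (shiftedFactorial ((n : ℝ) - (N : ℝ)) (m - t) / shiftedFactorial ((n : ℝ) + 2) (m - t))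
    * (shiftedFactorial ((N : ℝ) + 2 - (t : ℝ)) t / (t.factorial : ℝ))

/-- The entry `W(x)_{n,m}` of the weight for `m ≤ n`:
`√(1 - x²) ∑_{t=0}^m α_t(m,n) U_{n+m-2t}(x)`, with `U` the Chebyshev polynomials of the
second kind. -/
def weightEntry (N n m : ℕ) (x : ℝ) : ℝ :=
  Real.sqrt (1 - x ^ 2)
    * ∑ t ∈ Finset.range (m + 1),
        weightCoeff N t m n
          * (Polynomial.Chebyshev.U ℝ ((n : ℤ) + (m : ℤ) - 2 * (t : ℤ))).eval x

/-- The weight matrix `W(x)` of size `2ℓ + 1 = N + 1`, extended to `n < m` by symmetry. -/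
def weight (N : ℕ) (x : ℝ) : Matrix (Fin (N + 1)) (Fin (N + 1)) ℂ :=
  Matrix.of fun n m =>
    if m ≤ n then ((weightEntry N n m x : ℝ) : ℂ) else ((weightEntry N m n x : ℝ) : ℂ)

/-- The value `P(x) = ∑ₖ xᵏ Pₖ` of a polynomial with matrix coefficients `Pₖ` at a real
point `x`. -/
def matEval {N : ℕ} (P : Polynomial (Matrix (Fin (N + 1)) (Fin (N + 1)) ℂ)) (x : ℝ) :
    Matrix (Fin (N + 1)) (Fin (N + 1)) ℂ :=
  P.sum fun k A => ((x : ℂ) ^ k) • A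

/-- The matrix-valued inner product `⟨P, Q⟩_W = ∫_{-1}^1 P(x) W(x) Q(x)^* dx`, the integral
being taken entrywise (all integrands are continuous). -/
def weightInner (N : ℕ) (P Q : Polynomial (Matrix (Fin (N + 1)) (Fin (N + 1)) ℂ)) :
    Matrix (Fin (N + 1)) (Fin (N + 1)) ℂ :=
  Matrix.of fun i j =>
    ∫ x in (-1 : ℝ)..1, (matEval P x * weight N x * (matEval Q x)ᴴ) i j

/-- `P` is a sequence of monic orthogonal polynomials for `W`: `P n` has degree `n` and leading
coefficient the identity matrix, and `⟨P n, P m⟩_W = 0` for `n ≠ m`. -/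
def IsMonicOrthogonal (N : ℕ)
    (P : ℕ → Polynomial (Matrix (Fin (N + 1)) (Fin (N + 1)) ℂ)) : Prop :=
  (∀ n, (P n).Monic ∧ (P n).natDegree = n) ∧
    ∀ n m, n ≠ m → weightInner N (P n) (P m) = 0

/-- The flip matrix `J` with `J_{n,m} = δ_{n+m,2ℓ}`. -/
def flipMatrix (N : ℕ) : Matrix (Fin (N + 1)) (Fin (N + 1)) ℂ :=
  Matrix.of fun i j => if (i : ℕ) + (j : ℕ) = N then 1 else 0

/-- The claimed diagonal entry of the squared norm matrix `H_n` at position `i`, where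
`N = 2ℓ`. -/
def squaredNormEntry (N n i : ℕ) : ℝ :=
  Real.pi / 2
    * (((n.factorial : ℝ) ^ 2 * shiftedFactorial ((N : ℝ) + 1) (n + 1) ^ 2)
        / (shiftedFactorial ((i : ℝ) + 1) n ^ 2
            * shiftedFactorial ((N : ℝ) - (i : ℝ) + 1) n ^ 2))
    * (((2 : ℝ) ^ (2 * n))⁻¹
        / (((n : ℝ) + (i : ℝ) + 1) * ((N : ℝ) - (i : ℝ) + (n : ℝ) + 1)))

end

/-! The proof computes the Chebyshev moments `M_k(P) = ∫ U_k P W` in closed form. Expanding `W` in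
the `U_k`, orthogonality of the `U_k` gives the moments of `P = 1`, and each entry is a single
product of factorials (`weightCoeff_eq`, `integral_U_mul_weight`). This product is the case `n = 0`
of a family `stretchedCoeff` satisfying a contiguous relation (`stretchedCoeff_recurrence`). After a
row-dependent normalisation, that relation is a three-term recurrence `P_{n+2} = (X - B) P_{n+1} - C
P_n` with explicit tridiagonal `B` and diagonal `C`. Taking the recurrence as the definition of
`P_n`, induction gives every moment of `P_n` (`chebyshevMoment_monicOrthogonal`). The remaining
factor `j! (N - j)!` depends only on the column, so multiplication by matrices on the left leaves it
alone.

The closed form vanishes for `k < n` and is diagonal with positive entries for `k = n`. Since `x^n`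
is `2^{-n} U_n` plus lower terms, vanishing gives orthogonality and `H_n = 2^{-n} M_n(P_n)`.
Invertibility of `M_n(P_n)` gives uniqueness, with no appeal to positivity of `W`. -/

/-! ### Orthogonality of the Chebyshev polynomials of the second kind -/

/-- The Chebyshev polynomials of the second kind are orthogonal for `√(1 - x²)` on `[-1, 1]`. -/
theorem integral_sqrt_mul_U_mul_U {k j : ℤ} (hk : 0 ≤ k) (hj : 0 ≤ j) :
    ∫ x in (-1 : ℝ)..1, Real.sqrt (1 - x ^ 2) *
        ((Polynomial.Chebyshev.U ℝ j).eval x * (Polynomial.Chebyshev.U ℝ k).eval x)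
      = if j = k then Real.pi / 2 else 0 := by
  have h1 : ∫ x in (-1 : ℝ)..1, Real.sqrt (1 - x ^ 2) *
        ((Polynomial.Chebyshev.U ℝ j).eval x * (Polynomial.Chebyshev.U ℝ k).eval x)
      = ∫ x, ((Polynomial.Chebyshev.T ℝ (j - k)).eval x -
          (Polynomial.Chebyshev.T ℝ (j + k + 2)).eval x) / 2 ∂Polynomial.Chebyshev.measureT := by
    rw [Polynomial.Chebyshev.integral_measureT]
    refine intervalIntegral.integral_congr fun x hx => ?_
    rw [Set.uIcc_of_le (by norm_num)] at hx
    obtain ⟨θ, rfl⟩ : ∃ θ, x = Real.cos θ := ⟨Real.arccos x, (Real.cos_arccos hx.1 hx.2).symm⟩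
    have hs : 1 - Real.cos θ ^ 2 = Real.sin θ ^ 2 := by rw [Real.sin_sq]
    have hU (n : ℤ) := Polynomial.Chebyshev.U_real_cos θ n
    simp only [Polynomial.Chebyshev.T_real_cos, hs, Real.sqrt_sq_eq_abs, Real.sqrt_inv]
    -- At `x = cos θ` this is `sin² θ U_j U_k = (T_{j-k} - T_{j+k+2}) / 2`, which reduces the claim
    -- to the integrals of the `T_n`.
    have key : (Real.cos (((j - k : ℤ) : ℝ) * θ) - Real.cos (((j + k + 2 : ℤ) : ℝ) * θ)) / 2
        = Real.sin θ ^ 2 * ((Polynomial.Chebyshev.U ℝ j).eval (Real.cos θ) *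
          (Polynomial.Chebyshev.U ℝ k).eval (Real.cos θ)) := by
      rw [Real.cos_sub_cos]
      have e1 : (((j - k : ℤ) : ℝ) * θ + ((j + k + 2 : ℤ) : ℝ) * θ) / 2 = ((j : ℝ) + 1) * θ := by
        push_cast; ring
      have e2 : (((j - k : ℤ) : ℝ) * θ - ((j + k + 2 : ℤ) : ℝ) * θ) / 2 = -(((k : ℝ) + 1) * θ) := by
        push_cast; ring
      rw [e1, e2, Real.sin_neg, ← hU, ← hU]
      ring
    rw [key]
    -- At the endpoints the density `1 / √(1 - x²)` takes the value `0⁻¹ = 0`, and both sides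
    -- vanish.
    rcases eq_or_ne (Real.sin θ) 0 with h0 | h0
    · simp [h0]
    · have : |Real.sin θ| ≠ 0 := abs_ne_zero.mpr h0
      rw [← sq_abs (Real.sin θ)]
      field_simp
  rw [h1, MeasureTheory.integral_div, MeasureTheory.integral_sub,
    Polynomial.Chebyshev.integral_eval_T_real_measureT_of_ne_zero (n := j + k + 2) (by omega)]
  · split_ifs with h
    · subst h
      rw [sub_self, Polynomial.Chebyshev.integral_eval_T_real_measureT_zero, sub_zero]
    · rw [Polynomial.Chebyshev.integral_eval_T_real_measureT_of_ne_zero (by omega)]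
      simp
  · exact Polynomial.Chebyshev.integrable_measureT (Polynomial.continuous _).continuousOn
  · exact Polynomial.Chebyshev.integrable_measureT (Polynomial.continuous _).continuousOn

/-! ### Factorial terms and their contiguous relations -/

noncomputable section

/-- The reciprocal factorial `1 / z!`, extended by zero to negative integers. -/
def invFact (z : ℤ) : ℝ := if 0 ≤ z then ((z.toNat.factorial : ℝ))⁻¹ else 0

theorem invFact_natCast (n : ℕ) : invFact n = ((n.factorial : ℝ))⁻¹ := by
  simp [invFact]

theorem invFact_of_neg {z : ℤ} (h : z < 0) : invFact z = 0 := by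
  simp [invFact, not_le.mpr h]

/-- Valid for all integers, including `z = 0`, because of the extension by zero. This and
`factQuot_succ_sub_one` let the recurrence below hold without boundary cases. -/
theorem invFact_sub_one (z : ℤ) : invFact (z - 1) = z * invFact z := by
  rcases lt_trichotomy z 0 with h | rfl | h
  · rw [invFact_of_neg h, invFact_of_neg (by omega)]; simp
  · rw [invFact_of_neg (by omega)]; simp
  · obtain ⟨n, rfl⟩ : ∃ n : ℕ, z = n + 1 := ⟨(z - 1).toNat, by omega⟩
    have : ((n : ℤ) + 1) = ((n + 1 : ℕ) : ℤ) := by push_cast; rfl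
    rw [add_sub_cancel_right, invFact_natCast, this, invFact_natCast, Nat.factorial_succ]
    have := n.factorial_ne_zero
    push_cast
    field_simp

/-- The quotient `(n + a)! / a!`, extended by zero to negative `a`. -/
def factQuot (n : ℕ) (a : ℤ) : ℝ := ((n + a.toNat).factorial : ℝ) * invFact a

theorem factQuot_natCast (n a : ℕ) :
    factQuot n a = ((n + a).factorial : ℝ) / (a.factorial : ℝ) := by
  simp [factQuot, invFact_natCast, div_eq_mul_inv]

theorem factQuot_of_neg (n : ℕ) {a : ℤ} (h : a < 0) : factQuot n a = 0 := by
  simp [factQuot, invFact_of_neg h]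

theorem factQuot_zero {a : ℤ} (h : 0 ≤ a) : factQuot 0 a = 1 := by
  lift a to ℕ using h
  rw [factQuot_natCast, zero_add, div_self (by exact_mod_cast a.factorial_ne_zero)]

theorem factQuot_succ (n : ℕ) (a : ℤ) : factQuot (n + 1) a = (n + 1 + a) * factQuot n a := by
  rcases lt_or_ge a 0 with h | h
  · simp [factQuot_of_neg _ h]
  · lift a to ℕ using h
    rw [factQuot_natCast, factQuot_natCast, show n + 1 + a = (n + a) + 1 by ring,
      Nat.factorial_succ]
    push_cast
    ring

theorem factQuot_succ_sub_one (n : ℕ) (a : ℤ) :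
    factQuot (n + 1) (a - 1) = a * factQuot n a := by
  rcases lt_trichotomy a 0 with h | rfl | h
  · rw [factQuot_of_neg _ h, factQuot_of_neg _ (by omega)]; simp
  · rw [factQuot_of_neg _ (by omega)]; simp
  · have e : n + 1 + (a - 1).toNat = n + a.toNat := by omega
    rw [factQuot, factQuot, e, invFact_sub_one]
    ring

/-- The stretched hypergeometric term in the parameters `a, b, c` and `d = N - a - b - c`. -/
def stretchedTerm (N n : ℕ) (a b c d : ℤ) : ℝ :=
  factQuot n a * factQuot n b * invFact c * invFact d
    * invFact (N + n + 1 - d) * invFact (N + n + 1 - c)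

/-- Every term is a polynomial multiple of one common product, built from `factQuot n` at `a, b` and
`invFact` at `c, d, N + n + 3 - c, N + n + 3 - d`. With `N` eliminated, a polynomial identity
remains. -/
theorem stretchedTerm_recurrence (N n : ℕ) {a b c d : ℤ} (h : a + b + c + d = N + 2) :
    ((n : ℝ) + 1 + b + c) * (n + 1 + a + d) *
      (stretchedTerm N (n + 1) a b (c - 1) (d - 1)
        + stretchedTerm N (n + 1) (a - 1) (b - 1) c d)
    = ((N : ℝ) + n + 3) ^ 2 * stretchedTerm N (n + 2) (a - 1) (b - 1) c d
      + ((a : ℝ) + d) ^ 2 * stretchedTerm N (n + 1) a (b - 1) (c - 1) d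
      + ((b : ℝ) + c) ^ 2 * stretchedTerm N (n + 1) (a - 1) b c (d - 1)
      + ((n : ℝ) + 1) ^ 2 * stretchedTerm N n a b (c - 1) (d - 1) := by
  have hN : (N : ℝ) = a + b + c + d - 2 := by
    have : ((a + b + c + d : ℤ) : ℝ) = ((N + 2 : ℤ) : ℝ) := by rw [h]
    push_cast at this
    linarith
  have e1 (z : ℤ) : invFact ((N : ℤ) + ((n + 1 : ℕ) : ℤ) + 1 - (z - 1))
      = invFact (N + n + 3 - z) := by
    congr 1; push_cast; omega
  have e2 (z : ℤ) : invFact ((N : ℤ) + ((n + 1 : ℕ) : ℤ) + 1 - z)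
      = (N + n + 3 - z) * invFact (N + n + 3 - z) := by
    rw [show (N : ℤ) + ((n + 1 : ℕ) : ℤ) + 1 - z = N + n + 3 - z - 1 by push_cast; ring,
      invFact_sub_one]
    push_cast; ring
  have e3 (z : ℤ) : invFact ((N : ℤ) + ((n + 2 : ℕ) : ℤ) + 1 - z)
      = invFact (N + n + 3 - z) := by
    congr 1
  have e4 (z : ℤ) : invFact ((N : ℤ) + n + 1 - (z - 1))
      = (N + n + 3 - z) * invFact (N + n + 3 - z) := by
    rw [show (N : ℤ) + n + 1 - (z - 1) = N + n + 3 - z - 1 by ring, invFact_sub_one]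
    push_cast; ring
  have f (z : ℤ) : factQuot (n + 2) (z - 1) = (n + 2 + (z - 1)) * (z * factQuot n z) := by
    rw [factQuot_succ, factQuot_succ_sub_one]
    push_cast
    ring
  simp only [stretchedTerm]
  rw [e1, e1, e2, e2, e3, e3, e4, e4, f, f, factQuot_succ_sub_one, factQuot_succ_sub_one,
    invFact_sub_one, invFact_sub_one, factQuot_succ, factQuot_succ, hN]
  ring

/-- Formally the previous relation at `n = -1`, where the last coefficient vanishes. It fails in
general at `a = b = 0`, where the right side is zero and the left need not be. -/
theorem stretchedTerm_recurrence_zero (N : ℕ) {a b c d : ℤ} (h : a + b + c + d = N + 2)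
    (hab : 1 ≤ a + b) :
    ((b : ℝ) + c) * (a + d) *
      (stretchedTerm N 0 a b (c - 1) (d - 1) + stretchedTerm N 0 (a - 1) (b - 1) c d)
    = ((N : ℝ) + 2) ^ 2 * stretchedTerm N 1 (a - 1) (b - 1) c d
      + ((a : ℝ) + d) ^ 2 * stretchedTerm N 0 a (b - 1) (c - 1) d
      + ((b : ℝ) + c) ^ 2 * stretchedTerm N 0 (a - 1) b c (d - 1) := by
  have hN : (N : ℝ) = a + b + c + d - 2 := by
    have : ((a + b + c + d : ℤ) : ℝ) = ((N + 2 : ℤ) : ℝ) := by rw [h]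
    push_cast at this
    linarith
  have e1 (z : ℤ) : invFact ((N : ℤ) + ((0 : ℕ) : ℤ) + 1 - (z - 1)) = invFact (N + 2 - z) := by
    congr 1; push_cast; omega
  have e2 (z : ℤ) : invFact ((N : ℤ) + ((0 : ℕ) : ℤ) + 1 - z)
      = (N + 2 - z) * invFact (N + 2 - z) := by
    rw [show (N : ℤ) + ((0 : ℕ) : ℤ) + 1 - z = N + 2 - z - 1 by push_cast; ring,
      invFact_sub_one]
    push_cast; ring
  have e3 (z : ℤ) : invFact ((N : ℤ) + ((1 : ℕ) : ℤ) + 1 - z) = invFact (N + 2 - z) := by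
    congr 1
  have f (z : ℤ) : factQuot 1 (z - 1) = z * factQuot 0 z := factQuot_succ_sub_one 0 z
  simp only [stretchedTerm]
  rw [e1, e1, e2, e2, e3, e3, f, f, invFact_sub_one, invFact_sub_one]
  -- `factQuot 0` is the indicator of the nonnegative integers, so the edges `a = 0` and `b = 0`
  -- need separate treatment.
  rcases lt_or_ge a 0 with ha | ha
  · simp [factQuot_of_neg _ ha, factQuot_of_neg _ (show a - 1 < 0 by omega)]
  rcases lt_or_ge b 0 with hb | hb
  · simp [factQuot_of_neg _ hb, factQuot_of_neg _ (show b - 1 < 0 by omega)]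
  rw [factQuot_zero ha, factQuot_zero hb]
  rcases ha.eq_or_lt with rfl | ha
  · rw [factQuot_of_neg _ (show (0 : ℤ) - 1 < 0 by omega), factQuot_zero (a := b - 1) (by omega), hN]
    push_cast
    ring
  rcases hb.eq_or_lt with rfl | hb
  · rw [factQuot_of_neg _ (show (0 : ℤ) - 1 < 0 by omega), factQuot_zero (a := a - 1) (by omega), hN]
    push_cast
    ring
  rw [factQuot_zero (a := b - 1) (by omega), factQuot_zero (a := a - 1) (by omega), hN]
  ring

/-- The normalised integrals of `U_k P_n W` as a function of the row `i` and the column `j`. -/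
def stretchedCoeff (N n : ℕ) (i j k : ℤ) : ℝ :=
  if Even (k + j - n - i) then
    stretchedTerm N n ((k + j - n - i) / 2) ((k - j - n + i) / 2) ((n + i + j - k) / 2)
      ((n + 2 * N - i - j - k) / 2)
  else 0

theorem stretchedCoeff_eq (N n : ℕ) {i j k a b c d : ℤ} (ha : k + j - n - i = 2 * a)
    (hb : k - j - n + i = 2 * b) (hc : n + i + j - k = 2 * c) (hd : a + b + c + d = N) :
    stretchedCoeff N n i j k = stretchedTerm N n a b c d := by
  rw [stretchedCoeff, if_pos (by rw [ha]; exact even_two_mul a)]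
  congr 1 <;> omega

theorem stretchedCoeff_of_odd (N n : ℕ) {i j k : ℤ} (h : ¬ Even (k + j - n - i)) :
    stretchedCoeff N n i j k = 0 := if_neg h

/-- The parameters `a` and `b` sum to `k - n < 0`, so one of them is negative. -/
theorem stretchedCoeff_of_lt (N n : ℕ) {i j k : ℤ} (h : k < n) :
    stretchedCoeff N n i j k = 0 := by
  rw [stretchedCoeff]
  split_ifs with he
  · obtain ⟨a, ha⟩ := he
    rw [stretchedTerm]
    rcases lt_or_ge a 0 with h0 | h0
    · rw [factQuot_of_neg _ (show (k + j - n - i) / 2 < 0 by omega)]; simp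
    · rw [factQuot_of_neg _ (show (k - j - n + i) / 2 < 0 by omega)]; simp
  · rfl

/-- At `k = n` the parameters satisfy `a + b = 0`, so only `a = b = 0` survives, which means `i =
j`. -/
theorem stretchedCoeff_self (N n : ℕ) (i j : ℤ) :
    stretchedCoeff N n i j n = if i = j then
      (n.factorial : ℝ) ^ 2 * (invFact i * invFact (N - i) * invFact (n + 1 + i)
        * invFact (N + n + 1 - i)) else 0 := by
  split_ifs with h
  · subst h
    rw [stretchedCoeff_eq N n (a := 0) (b := 0) (c := i) (d := N - i) (by ring) (by ring)
      (by ring) (by ring),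
      stretchedTerm, show (0 : ℤ) = ((0 : ℕ) : ℤ) from rfl, factQuot_natCast]
    simp only [show (N : ℤ) + n + 1 - (N - i) = n + 1 + i by ring]
    simp
    ring
  · rw [stretchedCoeff]
    split_ifs with he
    · obtain ⟨a, ha⟩ := he
      rw [stretchedTerm]
      rcases lt_or_ge a 0 with h0 | h0
      · rw [factQuot_of_neg _ (show ((n : ℤ) + j - n - i) / 2 < 0 by omega)]; simp
      · rw [factQuot_of_neg _ (show ((n : ℤ) - j - n + i) / 2 < 0 by omega)]; simp
    · rfl

/-- In the shifted parameters `b + c = i + 1` and `a + d = N - i + 1`, so this is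
`stretchedTerm_recurrence`. All six terms share one parity condition, and in the odd case all are
zero. -/
theorem stretchedCoeff_recurrence (N n : ℕ) (i j k : ℤ) :
    ((n : ℝ) + 1 + i + 1) * (N - i + (n + 1) + 1) *
      (stretchedCoeff N (n + 1) i j (k + 1) + stretchedCoeff N (n + 1) i j (k - 1))
    = ((N : ℝ) + n + 3) ^ 2 * stretchedCoeff N (n + 2) i j k
      + ((N : ℝ) - i + 1) ^ 2 * stretchedCoeff N (n + 1) (i - 1) j k
      + ((i : ℝ) + 1) ^ 2 * stretchedCoeff N (n + 1) (i + 1) j k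
      + ((n : ℝ) + 1) ^ 2 * stretchedCoeff N n i j k := by
  by_cases he : Even (k + j - n - i)
  · obtain ⟨a, ha⟩ := he
    obtain ⟨b, hb⟩ : ∃ b, b = k - n - a := ⟨_, rfl⟩
    obtain ⟨c, hc⟩ : ∃ c, c = i + 1 - b := ⟨_, rfl⟩
    obtain ⟨d, hd⟩ : ∃ d, d = N + 1 - i - a := ⟨_, rfl⟩
    have hc' : (c : ℝ) = i + 1 - b := by exact_mod_cast hc
    have hd' : (d : ℝ) = N + 1 - i - a := by exact_mod_cast hd
    rw [stretchedCoeff_eq N (n + 1) (a := a) (b := b) (c := c - 1) (d := d - 1)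
        (by omega) (by omega) (by omega) (by omega),
      stretchedCoeff_eq N (n + 1) (a := a - 1) (b := b - 1) (c := c) (d := d)
        (by omega) (by omega) (by omega) (by omega),
      stretchedCoeff_eq N (n + 2) (a := a - 1) (b := b - 1) (c := c) (d := d)
        (by omega) (by omega) (by omega) (by omega),
      stretchedCoeff_eq N (n + 1) (a := a) (b := b - 1) (c := c - 1) (d := d)
        (by omega) (by omega) (by omega) (by omega),
      stretchedCoeff_eq N (n + 1) (a := a - 1) (b := b) (c := c) (d := d - 1)
        (by omega) (by omega) (by omega) (by omega),
      stretchedCoeff_eq N n (a := a) (b := b) (c := c - 1) (d := d - 1)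
        (by omega) (by omega) (by omega) (by omega),
      show (n : ℝ) + 1 + i + 1 = n + 1 + b + c by rw [hc']; ring,
      show (N : ℝ) - i + (n + 1) + 1 = n + 1 + a + d by rw [hd']; ring,
      show (N : ℝ) - i + 1 = a + d by rw [hd']; ring,
      show (i : ℝ) + 1 = b + c by rw [hc']; ring]
    exact stretchedTerm_recurrence N n (by omega)
  · have hp : ∀ z : ℤ, z = k + j - n - i + 2 ∨ z = k + j - n - i - 2 ∨ z = k + j - n - i →
        ¬ Even z := by
      intro z hz hz'
      apply he
      rw [Int.even_iff] at *
      omega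
    rw [stretchedCoeff_of_odd, stretchedCoeff_of_odd, stretchedCoeff_of_odd,
      stretchedCoeff_of_odd, stretchedCoeff_of_odd, stretchedCoeff_of_odd]
    · simp
    all_goals apply hp; push_cast; omega

theorem stretchedCoeff_recurrence_zero (N : ℕ) (i j : ℤ) {k : ℤ} (hk : 0 ≤ k) :
    ((i : ℝ) + 1) * (N - i + 1) *
      (stretchedCoeff N 0 i j (k + 1) + stretchedCoeff N 0 i j (k - 1))
    = ((N : ℝ) + 2) ^ 2 * stretchedCoeff N 1 i j k
      + ((N : ℝ) - i + 1) ^ 2 * stretchedCoeff N 0 (i - 1) j k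
      + ((i : ℝ) + 1) ^ 2 * stretchedCoeff N 0 (i + 1) j k := by
  by_cases he : Even (k + j + 1 - i)
  · obtain ⟨a, ha⟩ := he
    obtain ⟨b, hb⟩ : ∃ b, b = k + 1 - a := ⟨_, rfl⟩
    obtain ⟨c, hc⟩ : ∃ c, c = i + 1 - b := ⟨_, rfl⟩
    obtain ⟨d, hd⟩ : ∃ d, d = N + 1 - i - a := ⟨_, rfl⟩
    have hc' : (c : ℝ) = i + 1 - b := by exact_mod_cast hc
    have hd' : (d : ℝ) = N + 1 - i - a := by exact_mod_cast hd
    rw [stretchedCoeff_eq N 0 (a := a) (b := b) (c := c - 1) (d := d - 1)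
        (by omega) (by omega) (by omega) (by omega),
      stretchedCoeff_eq N 0 (a := a - 1) (b := b - 1) (c := c) (d := d)
        (by omega) (by omega) (by omega) (by omega),
      stretchedCoeff_eq N 1 (a := a - 1) (b := b - 1) (c := c) (d := d)
        (by omega) (by omega) (by omega) (by omega),
      stretchedCoeff_eq N 0 (a := a) (b := b - 1) (c := c - 1) (d := d)
        (by omega) (by omega) (by omega) (by omega),
      stretchedCoeff_eq N 0 (a := a - 1) (b := b) (c := c) (d := d - 1)
        (by omega) (by omega) (by omega) (by omega),
      show (N : ℝ) - i + 1 = a + d by rw [hd']; ring,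
      show (i : ℝ) + 1 = b + c by rw [hc']; ring]
    exact stretchedTerm_recurrence_zero N (by omega) (by omega)
  · have hp : ∀ z : ℤ, z = k + j + 1 - i ∨ z = k + j + 1 - i - 2 →
        ¬ Even z := by
      intro z hz hz'
      apply he
      rw [Int.even_iff] at *
      omega
    rw [stretchedCoeff_of_odd, stretchedCoeff_of_odd, stretchedCoeff_of_odd,
      stretchedCoeff_of_odd, stretchedCoeff_of_odd]
    · simp
    all_goals apply hp; push_cast; omega

/-! ### Chebyshev moments of the weight -/

open Polynomial

theorem shiftedFactorial_natCast_add_one (m k : ℕ) :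
    shiftedFactorial ((m : ℝ) + 1) k = ((m + k).factorial : ℝ) / (m.factorial : ℝ) := by
  rw [shiftedFactorial, eq_div_iff (by exact_mod_cast m.factorial_ne_zero),
    ← Nat.factorial_mul_ascFactorial, ← ascPochhammer_nat_eq_ascFactorial]
  have := ascPochhammer_eval_cast ℝ k (m + 1)
  push_cast at this ⊢
  rw [this, mul_comm]

/-- Both sides vanish for `r > M`, so the truncation in `(n - 2ℓ)_{m-t}` is carried by `invFact`. -/
theorem neg_one_pow_mul_shiftedFactorial_neg (M r : ℕ) :
    (-1) ^ r * shiftedFactorial (-(M : ℝ)) r = (M.factorial : ℝ) * invFact (M - r) := by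
  induction r with
  | zero =>
    have := M.factorial_ne_zero
    simp [shiftedFactorial, invFact_natCast, this]
  | succ r ih =>
    have h : shiftedFactorial (-(M : ℝ)) (r + 1)
        = shiftedFactorial (-(M : ℝ)) r * (-(M : ℝ) + r) := by
      rw [shiftedFactorial, ascPochhammer_succ_eval, shiftedFactorial]
    rw [h, show (M : ℤ) - ((r + 1 : ℕ) : ℤ) = (M - r) - 1 by push_cast; ring, invFact_sub_one]
    push_cast
    linear_combination (M - r : ℝ) * ih

theorem weightCoeff_eq (N : ℕ) {t m n : ℕ} (ht : t ≤ m) (hm : m ≤ n) (hn : n ≤ N) :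
    weightCoeff N t m n = ((N : ℝ) + 1) ^ 2 * (n.factorial * (N - n).factorial)
      * (m.factorial * (N - m).factorial)
      * stretchedTerm N 0 (m - t) (n - t) t (N - n - m + t) := by
  obtain ⟨r, rfl⟩ := Nat.exists_eq_add_of_le ht
  obtain ⟨M, rfl⟩ := Nat.exists_eq_add_of_le hn
  -- Here `q = N - t`, so that `(N + 2 - t)_t` becomes `(N + 1)! / (q + 1)!`.
  obtain ⟨q, hq⟩ := Nat.exists_eq_add_of_le (show t ≤ n + M by omega)
  have h1 := neg_one_pow_mul_shiftedFactorial_neg M r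
  have h2 := shiftedFactorial_natCast_add_one (n + 1) r
  have h3 := shiftedFactorial_natCast_add_one (q + 1) t
  have e3 : ((n + M : ℕ) : ℝ) + 2 - t = ((q + 1 : ℕ) : ℝ) + 1 := by
    rw [hq]; push_cast; ring
  rw [weightCoeff, e3, h3, show (n : ℝ) - ((n + M : ℕ) : ℝ) = -M by push_cast; ring,
    show (n : ℝ) + 2 = ((n + 1 : ℕ) : ℝ) + 1 by push_cast; ring,
    show t + r - t = r by omega, show n + M - n = M by omega, h2, stretchedTerm, factQuot_zero (by push_cast; omega),
    factQuot_zero (by omega),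
    show ((n + M : ℕ) : ℤ) - n - ((t + r : ℕ) : ℤ) + t = M - r by push_cast; ring,
    show ((n + M : ℕ) : ℤ) + ((0 : ℕ) : ℤ) + 1 - (M - r) = ((n + 1 + r : ℕ) : ℤ) by
      push_cast; ring,
    show ((n + M : ℕ) : ℤ) + ((0 : ℕ) : ℤ) + 1 - t = ((q + 1 : ℕ) : ℤ) by
      rw [hq]; push_cast; ring,
    invFact_natCast, invFact_natCast, invFact_natCast]
  have h4 : ((q + 1 + t).factorial : ℝ) = (n + M + 1) * ((n + M).factorial : ℝ) := by
    rw [show q + 1 + t = (n + M) + 1 by omega, Nat.factorial_succ]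
    push_cast; ring
  have h5 : ((n + 1).factorial : ℝ) = (n + 1) * (n.factorial : ℝ) := by
    rw [Nat.factorial_succ]; push_cast; ring
  rw [h4, h5]
  have f1 : ((n + 1 + r).factorial : ℝ) ≠ 0 := by exact_mod_cast Nat.factorial_ne_zero _
  have f2 : ((n + M).factorial : ℝ) ≠ 0 := by exact_mod_cast Nat.factorial_ne_zero _
  have f3 : ((q + 1).factorial : ℝ) ≠ 0 := by exact_mod_cast Nat.factorial_ne_zero _
  have f4 : (t.factorial : ℝ) ≠ 0 := by exact_mod_cast Nat.factorial_ne_zero _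
  have f5 : (n.factorial : ℝ) ≠ 0 := by exact_mod_cast Nat.factorial_ne_zero _
  have f6 : (n : ℝ) + 1 ≠ 0 := by positivity
  push_cast
  field_simp
  linear_combination h1

theorem stretchedTerm_swap (N n : ℕ) (a b c d : ℤ) :
    stretchedTerm N n a b c d = stretchedTerm N n b a c d := by
  simp only [stretchedTerm]
  ring

/-- For `n = 0`, exchanging `i` and `j` exchanges `a` and `b` and fixes `c` and `d`. This covers the
entries of `W` that are defined by symmetry. -/
theorem stretchedCoeff_zero_comm (N : ℕ) (i j k : ℤ) :
    stretchedCoeff N 0 i j k = stretchedCoeff N 0 j i k := by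
  by_cases h : Even (k + j - ((0 : ℕ) : ℤ) - i)
  · obtain ⟨a, ha⟩ := h
    rw [stretchedCoeff_eq N 0 (a := a) (b := k - a) (c := i + a - k) (d := N - i - a) (by omega)
        (by omega) (by omega) (by omega),
      stretchedCoeff_eq N 0 (a := k - a) (b := a) (c := i + a - k) (d := N - i - a) (by omega)
        (by omega) (by omega) (by omega), stretchedTerm_swap]
  · rw [stretchedCoeff_of_odd N 0 h, stretchedCoeff_of_odd]
    rw [Int.even_iff] at *
    omega

/-- Here `b + c = i`; in the next lemma `a + d = N - i`. Together they make the tridiagonal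
recurrence close up at the rows `-1` and `N + 1`. -/
theorem stretchedCoeff_of_row_neg (N n : ℕ) {i j k : ℤ} (hi : i < 0) :
    stretchedCoeff N n i j k = 0 := by
  rw [stretchedCoeff]
  split_ifs with he
  · obtain ⟨a, ha⟩ := he
    rw [stretchedTerm]
    rcases lt_or_ge ((k - j - n + i) / 2) 0 with h0 | h0
    · rw [factQuot_of_neg _ h0]; simp
    · rw [invFact_of_neg (show ((n : ℤ) + i + j - k) / 2 < 0 by omega)]; simp
  · rfl

theorem stretchedCoeff_of_row_gt (N n : ℕ) {i j k : ℤ} (hi : N < i) :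
    stretchedCoeff N n i j k = 0 := by
  rw [stretchedCoeff]
  split_ifs with he
  · obtain ⟨a, ha⟩ := he
    rw [stretchedTerm]
    rcases lt_or_ge ((k + j - n - i) / 2) 0 with h0 | h0
    · rw [factQuot_of_neg _ h0]; simp
    · rw [invFact_of_neg (show ((n : ℤ) + 2 * N - i - j - k) / 2 < 0 by omega)]; simp
  · rfl

theorem continuous_weightEntry (N n m : ℕ) : Continuous (weightEntry N n m) := by
  unfold weightEntry
  fun_prop

theorem integral_weightEntry_mul_U (N : ℕ) {m n : ℕ} (hm : m ≤ n) (hn : n ≤ N) {k : ℤ}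
    (hk : 0 ≤ k) :
    ∫ x in (-1 : ℝ)..1, (Chebyshev.U ℝ k).eval x * weightEntry N n m x
      = Real.pi / 2 * (((N : ℝ) + 1) ^ 2 * (n.factorial * (N - n).factorial)
          * (m.factorial * (N - m).factorial) * stretchedCoeff N 0 n m k) := by
  have h1 : ∀ x, (Chebyshev.U ℝ k).eval x * weightEntry N n m x
      = ∑ t ∈ Finset.range (m + 1), weightCoeff N t m n * (Real.sqrt (1 - x ^ 2) *
        ((Chebyshev.U ℝ ((n : ℤ) + (m : ℤ) - 2 * (t : ℤ))).eval x
          * (Chebyshev.U ℝ k).eval x)) := by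
    intro x
    rw [weightEntry, Finset.mul_sum, Finset.mul_sum]
    exact Finset.sum_congr rfl fun t _ => by ring
  simp_rw [h1]
  rw [intervalIntegral.integral_finsetSum
    fun t _ => Continuous.intervalIntegrable (by fun_prop) _ _]
  simp_rw [intervalIntegral.integral_const_mul]
  have h2 : ∀ t ∈ Finset.range (m + 1), weightCoeff N t m n *
      (∫ x in (-1 : ℝ)..1, Real.sqrt (1 - x ^ 2) *
        ((Chebyshev.U ℝ ((n : ℤ) + (m : ℤ) - 2 * (t : ℤ))).eval x
          * (Chebyshev.U ℝ k).eval x))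
      = if (n : ℤ) + m - 2 * t = k then weightCoeff N t m n * (Real.pi / 2) else 0 := by
    intro t ht
    rw [Finset.mem_range] at ht
    rw [integral_sqrt_mul_U_mul_U hk (by omega)]
    split_ifs <;> simp
  rw [Finset.sum_congr rfl h2]
  by_cases hex : ∃ t : ℕ, t ≤ m ∧ (n : ℤ) + m - 2 * t = k
  · obtain ⟨t, ht, htk⟩ := hex
    rw [Finset.sum_eq_single t, if_pos htk, weightCoeff_eq N ht hm hn,
      stretchedCoeff_eq N 0 (a := m - t) (b := n - t) (c := t) (d := N - n - m + t) (by omega)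
        (by omega) (by omega) (by omega)]
    · ring
    · intro s _ hs
      rw [if_neg (by omega)]
    · intro h
      simp at h
      omega
  · rw [Finset.sum_eq_zero]
    -- The candidate index is `t = c`. If it is not in `[0, m]`, then `c < 0` or `a = m - c < 0`.
    · have : stretchedCoeff N 0 n m k = 0 := by
        rw [stretchedCoeff]
        split_ifs with he
        · obtain ⟨a, ha⟩ := he
          rw [stretchedTerm]
          rcases lt_or_ge ((((0 : ℕ) : ℤ) + n + m - k) / 2) 0 with h0 | h0
          · rw [invFact_of_neg h0]; simp
          · have : (k + m - ((0 : ℕ) : ℤ) - n) / 2 < 0 := by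
              by_contra hcon
              exact hex ⟨(((n : ℤ) + m - k) / 2).toNat, by omega, by omega⟩
            rw [factQuot_of_neg _ this]; simp
        · rfl
      rw [this]; ring
    · intro t ht
      rw [Finset.mem_range] at ht
      rw [if_neg fun h => hex ⟨t, by omega, h⟩]

theorem integral_U_mul_weight (N : ℕ) (i j : Fin (N + 1)) {k : ℤ} (hk : 0 ≤ k) :
    ∫ x in (-1 : ℝ)..1, (((Chebyshev.U ℝ k).eval x : ℝ) : ℂ) * weight N x i j
      = ((Real.pi / 2 * (((N : ℝ) + 1) ^ 2 * ((i : ℕ).factorial * (N - i).factorial)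
          * ((j : ℕ).factorial * (N - j).factorial) * stretchedCoeff N 0 i j k) : ℝ) : ℂ) := by
  by_cases h : j ≤ i
  · simp only [weight, Matrix.of_apply, if_pos h]
    rw [← integral_weightEntry_mul_U N (show (j : ℕ) ≤ i from h) (by omega) hk,
      ← intervalIntegral.integral_ofReal]
    simp
  · simp only [weight, Matrix.of_apply, if_neg h]
    rw [stretchedCoeff_zero_comm, mul_right_comm (((N : ℝ) + 1) ^ 2),
      ← integral_weightEntry_mul_U N (show (i : ℕ) ≤ j by omega) (by omega) hk,
      ← intervalIntegral.integral_ofReal]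
    simp

/-! ### Matrix polynomials and their Chebyshev moments -/

section MatrixPolynomial

variable {N : ℕ}

/-- Scalar matrices commute with all coefficients, so evaluation behaves as in the commutative case.
-/
theorem matEval_eq_eval (P : (Matrix (Fin (N + 1)) (Fin (N + 1)) ℂ)[X]) (x : ℝ) :
    matEval P x = P.eval ((x : ℂ) • 1) := by
  rw [matEval, eval_eq_sum]
  simp only [_root_.smul_pow, one_pow, mul_smul_comm, mul_one]

theorem matEval_one (x : ℝ) : matEval (1 : (Matrix (Fin (N + 1)) (Fin (N + 1)) ℂ)[X]) x = 1 := by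
  rw [matEval_eq_eval, eval_one]

theorem matEval_sub (P Q : (Matrix (Fin (N + 1)) (Fin (N + 1)) ℂ)[X]) (x : ℝ) :
    matEval (P - Q) x = matEval P x - matEval Q x := by
  simp only [matEval_eq_eval, eval_sub]

theorem matEval_C_mul (A : Matrix (Fin (N + 1)) (Fin (N + 1)) ℂ)
    (P : (Matrix (Fin (N + 1)) (Fin (N + 1)) ℂ)[X]) (x : ℝ) :
    matEval (C A * P) x = A * matEval P x := by
  simp only [matEval_eq_eval, eval_C_mul]

theorem matEval_X_mul (P : (Matrix (Fin (N + 1)) (Fin (N + 1)) ℂ)[X]) (x : ℝ) :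
    matEval (X * P) x = (x : ℂ) • matEval P x := by
  simp only [matEval_eq_eval, X_mul, eval_mul_X, mul_smul_comm, mul_one]

theorem matEval_X_pow_mul (P : (Matrix (Fin (N + 1)) (Fin (N + 1)) ℂ)[X]) (m : ℕ) (x : ℝ) :
    matEval (X ^ m * P) x = (x : ℂ) ^ m • matEval P x := by
  induction m with
  | zero => simp
  | succ m ih => rw [pow_succ', mul_assoc, matEval_X_mul, ih, smul_smul, pow_succ']

theorem continuous_matEval (P : (Matrix (Fin (N + 1)) (Fin (N + 1)) ℂ)[X]) :
    Continuous (matEval P) := by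
  unfold matEval Polynomial.sum
  fun_prop

theorem continuous_weight (N : ℕ) : Continuous (weight N) := by
  refine continuous_matrix fun i j => ?_
  simp only [weight, Matrix.of_apply]
  split_ifs
  · exact Complex.continuous_ofReal.comp (continuous_weightEntry N i j)
  · exact Complex.continuous_ofReal.comp (continuous_weightEntry N j i)

theorem weight_conjTranspose (N : ℕ) (x : ℝ) : (weight N x)ᴴ = weight N x := by
  ext i j
  simp only [weight, Matrix.conjTranspose_apply, Matrix.of_apply]
  rcases lt_trichotomy i j with h | rfl | h
  · rw [if_pos h.le, if_neg (not_le.mpr h)]; simp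
  · simp
  · rw [if_neg (not_le.mpr h), if_pos h.le]; simp

theorem continuous_matEval_mul_weight_apply (P : (Matrix (Fin (N + 1)) (Fin (N + 1)) ℂ)[X])
    (i j : Fin (N + 1)) : Continuous fun x => (matEval P x * weight N x) i j :=
  ((continuous_matEval P).matrix_mul (continuous_weight N)).matrix_elem i j

/-- The matrix of integrals `∫ U_k(x) P(x) W(x) dx` over `[-1, 1]`. -/
def chebyshevMoment (k : ℤ) (P : (Matrix (Fin (N + 1)) (Fin (N + 1)) ℂ)[X]) :
    Matrix (Fin (N + 1)) (Fin (N + 1)) ℂ :=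
  Matrix.of fun i j =>
    ∫ x in (-1 : ℝ)..1, (((Chebyshev.U ℝ k).eval x : ℝ) : ℂ) * (matEval P x * weight N x) i j

theorem intervalIntegrable_chebyshevMoment (k : ℤ)
    (P : (Matrix (Fin (N + 1)) (Fin (N + 1)) ℂ)[X]) (i j : Fin (N + 1)) :
    IntervalIntegrable
      (fun x : ℝ => (((Chebyshev.U ℝ k).eval x : ℝ) : ℂ) * (matEval P x * weight N x) i j)
      MeasureTheory.volume (-1) 1 := by
  exact ((Complex.continuous_ofReal.comp (Polynomial.continuous _)).mul
    (continuous_matEval_mul_weight_apply P i j)).intervalIntegrable _ _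

theorem chebyshevMoment_sub (k : ℤ) (P Q : (Matrix (Fin (N + 1)) (Fin (N + 1)) ℂ)[X]) :
    chebyshevMoment k (P - Q) = chebyshevMoment k P - chebyshevMoment k Q := by
  ext i j
  simp only [chebyshevMoment, Matrix.of_apply, Matrix.sub_apply, matEval_sub, sub_mul, mul_sub]
  exact intervalIntegral.integral_sub (intervalIntegrable_chebyshevMoment k P i j)
    (intervalIntegrable_chebyshevMoment k Q i j)

theorem chebyshevMoment_C_mul (k : ℤ) (A : Matrix (Fin (N + 1)) (Fin (N + 1)) ℂ)
    (P : (Matrix (Fin (N + 1)) (Fin (N + 1)) ℂ)[X]) :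
    chebyshevMoment k (C A * P) = A * chebyshevMoment k P := by
  ext i j
  simp only [chebyshevMoment, Matrix.of_apply, matEval_C_mul, mul_assoc,
    Matrix.mul_apply (M := A), Finset.mul_sum, mul_left_comm _ (A _ _)]
  rw [intervalIntegral.integral_finsetSum fun l _ =>
    (intervalIntegrable_chebyshevMoment k P l j).const_mul _]
  simp_rw [intervalIntegral.integral_const_mul]

/-- From `2 x U_k = U_{k+1} + U_{k-1}`. At `k = 0` the convention `U_{-1} = 0` keeps it valid. -/
theorem chebyshevMoment_X_mul (k : ℤ) (P : (Matrix (Fin (N + 1)) (Fin (N + 1)) ℂ)[X]) :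
    chebyshevMoment k (X * P)
      = (2 : ℂ)⁻¹ • (chebyshevMoment (k + 1) P + chebyshevMoment (k - 1) P) := by
  ext i j
  simp only [chebyshevMoment, Matrix.of_apply, Matrix.smul_apply, Matrix.add_apply]
  rw [← intervalIntegral.integral_add (intervalIntegrable_chebyshevMoment _ P i j)
    (intervalIntegrable_chebyshevMoment _ P i j), smul_eq_mul,
    ← intervalIntegral.integral_const_mul]
  refine intervalIntegral.integral_congr fun x _ => ?_
  have h := congrArg (fun p : ℝ[X] => ((p.eval x : ℝ) : ℂ)) (Chebyshev.U_add_one ℝ k)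
  simp only [eval_sub, eval_mul, eval_X, eval_ofNat, Complex.ofReal_sub, Complex.ofReal_mul,
    Complex.ofReal_ofNat] at h
  simp only [matEval_X_mul, Matrix.smul_mul, Matrix.smul_apply, smul_eq_mul, h]
  ring

theorem chebyshevMoment_neg_one (P : (Matrix (Fin (N + 1)) (Fin (N + 1)) ℂ)[X]) :
    chebyshevMoment (-1) P = 0 := by
  ext i j
  simp [chebyshevMoment]

/-- Expanding `Q` in powers of the real variable, with `U_0 = 1`, reduces inner products to moments.
-/
theorem weightInner_eq_sum (P Q : (Matrix (Fin (N + 1)) (Fin (N + 1)) ℂ)[X]) :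
    weightInner N P Q
      = ∑ m ∈ Q.support, chebyshevMoment 0 (X ^ m * P) * (Q.coeff m)ᴴ := by
  have hQ (x : ℝ) : matEval P x * weight N x * (matEval Q x)ᴴ
      = ∑ m ∈ Q.support, matEval (X ^ m * P) x * weight N x * (Q.coeff m)ᴴ := by
    rw [matEval.eq_1 Q, Polynomial.sum, Matrix.conjTranspose_sum, Finset.mul_sum]
    refine Finset.sum_congr rfl fun m _ => ?_
    rw [matEval_X_pow_mul, Matrix.conjTranspose_smul]
    simp
  ext i j
  have hc (m : ℕ) (l : Fin (N + 1)) : Continuous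
      (fun x : ℝ =>
        (matEval (X ^ m * P) x * weight N x : Matrix (Fin (N + 1)) (Fin (N + 1)) ℂ) i l * ((Q.coeff m)ᴴ) l j) :=
    (continuous_matEval_mul_weight_apply (X ^ m * P) i l).mul continuous_const
  simp only [weightInner, Matrix.of_apply, hQ, Matrix.sum_apply]
  simp only [Matrix.mul_apply (N := (coeff _ _)ᴴ)]
  rw [intervalIntegral.integral_finsetSum fun m _ =>
    (continuous_finsetSum _ fun l _ => hc m l).intervalIntegrable _ _]
  refine Finset.sum_congr rfl fun m _ => ?_
  rw [intervalIntegral.integral_finsetSum fun l _ => (hc m l).intervalIntegrable _ _]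
  refine Finset.sum_congr rfl fun l _ => ?_
  rw [intervalIntegral.integral_mul_const]
  simp [chebyshevMoment]

theorem weightInner_conjTranspose (P Q : (Matrix (Fin (N + 1)) (Fin (N + 1)) ℂ)[X]) :
    (weightInner N P Q)ᴴ = weightInner N Q P := by
  ext i j
  simp only [weightInner, Matrix.conjTranspose_apply, Matrix.of_apply]
  rw [← starRingEnd_apply, ← intervalIntegral.intervalIntegral_conj]
  refine intervalIntegral.integral_congr fun x _ => ?_
  have : matEval Q x * weight N x * (matEval P x)ᴴ
      = (matEval P x * weight N x * (matEval Q x)ᴴ)ᴴ := by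
    simp only [Matrix.conjTranspose_mul, Matrix.conjTranspose_conjTranspose,
      weight_conjTranspose, mul_assoc]
  simp only [this, Matrix.conjTranspose_apply, starRingEnd_apply]

theorem weightInner_sub_left (P Q R : (Matrix (Fin (N + 1)) (Fin (N + 1)) ℂ)[X]) :
    weightInner N (P - Q) R = weightInner N P R - weightInner N Q R := by
  simp only [weightInner_eq_sum, mul_sub, chebyshevMoment_sub, sub_mul, Finset.sum_sub_distrib]

/-! ### Orthogonality from vanishing moments -/

section Orthogonality

variable {P : (Matrix (Fin (N + 1)) (Fin (N + 1)) ℂ)[X]} {n : ℕ}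

/-- Each factor `X` shifts the moment index by one, so the moment involves only indices at most `m +
k < n` of `P`. -/
theorem chebyshevMoment_X_pow_mul_eq_zero (h : ∀ k : ℕ, k < n → chebyshevMoment k P = 0) (m : ℕ) :
    ∀ k : ℕ, m + k < n → chebyshevMoment k (X ^ m * P) = 0 := by
  induction m with
  | zero => simpa using h
  | succ m ih =>
    intro k hk
    rw [pow_succ', mul_assoc, chebyshevMoment_X_mul]
    have h1 := ih (k + 1) (by omega)
    push_cast at h1
    rw [h1]
    rcases k with _ | k
    · simp [chebyshevMoment_neg_one]
    · rw [show (((k + 1 : ℕ) : ℤ) - 1) = (k : ℤ) by push_cast; ring, ih k (by omega)]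
      simp

/-- Only raising the index at every step reaches `n`, and each step contributes a factor `1/2`. -/
theorem chebyshevMoment_X_pow_mul_eq (h : ∀ k : ℕ, k < n → chebyshevMoment k P = 0) (m : ℕ) :
    ∀ k : ℕ, m + k = n →
      chebyshevMoment k (X ^ m * P) = ((2 : ℂ) ^ m)⁻¹ • chebyshevMoment n P := by
  induction m with
  | zero =>
    intro k hk
    obtain rfl : k = n := by omega
    simp
  | succ m ih =>
    intro k hk
    rw [pow_succ', mul_assoc, chebyshevMoment_X_mul]
    have h1 := ih (k + 1) (by omega)
    push_cast at h1
    rw [h1]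
    have h2 : chebyshevMoment ((k : ℤ) - 1) (X ^ m * P) = 0 := by
      rcases k with _ | k
      · simp [chebyshevMoment_neg_one]
      · rw [show (((k + 1 : ℕ) : ℤ) - 1) = (k : ℤ) by push_cast; ring]
        exact chebyshevMoment_X_pow_mul_eq_zero h m k (by omega)
    rw [h2, add_zero, smul_smul, pow_succ', mul_inv]

theorem weightInner_eq_zero_of_natDegree_lt (h : ∀ k : ℕ, k < n → chebyshevMoment k P = 0)
    {Q : (Matrix (Fin (N + 1)) (Fin (N + 1)) ℂ)[X]} (hQ : Q.natDegree < n) :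
    weightInner N P Q = 0 := by
  rw [weightInner_eq_sum]
  refine Finset.sum_eq_zero fun m hm => ?_
  have := le_natDegree_of_mem_supp m hm
  have h0 := chebyshevMoment_X_pow_mul_eq_zero h m 0 (by omega)
  rw [Nat.cast_zero] at h0
  rw [h0, zero_mul]

theorem weightInner_eq_of_natDegree_eq (h : ∀ k : ℕ, k < n → chebyshevMoment k P = 0)
    {Q : (Matrix (Fin (N + 1)) (Fin (N + 1)) ℂ)[X]} (hQ : Q.natDegree = n) :
    weightInner N P Q = ((2 : ℂ) ^ n)⁻¹ • chebyshevMoment n P * Q.leadingCoeffᴴ := by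
  have h0 := chebyshevMoment_X_pow_mul_eq h n 0 (by omega)
  rw [Nat.cast_zero] at h0
  rw [weightInner_eq_sum, Finset.sum_eq_single n]
  · rw [h0, leadingCoeff, hQ]
  · intro m hm hmn
    have := le_natDegree_of_mem_supp m hm
    have h0 := chebyshevMoment_X_pow_mul_eq_zero h m 0 (by omega)
    rw [Nat.cast_zero] at h0
    rw [h0, zero_mul]
  · intro hn
    rw [notMem_support_iff.mp hn]
    simp

end Orthogonality

/-- A sequence of monic polynomials whose Chebyshev moments vanish below the diagonal and are
invertible on it is the unique sequence of monic orthogonal polynomials. -/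
theorem isMonicOrthogonal_iff_eq {p : ℕ → (Matrix (Fin (N + 1)) (Fin (N + 1)) ℂ)[X]}
    (hp : ∀ n, (p n).Monic ∧ (p n).natDegree = n)
    (h0 : ∀ n k : ℕ, k < n → chebyshevMoment k (p n) = 0)
    (hu : ∀ n : ℕ, IsUnit (chebyshevMoment n (p n))) (P : ℕ → _) :
    IsMonicOrthogonal N P ↔ P = p := by
  constructor
  · rintro ⟨hP, hPo⟩
    funext n
    induction n using Nat.strong_induction_on with
    | _ n ih =>
      by_contra hne
      have hd0 : P n - p n ≠ 0 := sub_ne_zero.mpr hne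
      have hdeg : (P n - p n).natDegree < n := by
        have hn : n ≠ 0 := by
          rintro rfl
          apply hne
          rw [(hP 0).1.natDegree_eq_zero.mp (hP 0).2, (hp 0).1.natDegree_eq_zero.mp (hp 0).2]
        have := natDegree_lt_natDegree hd0 (degree_sub_lt_left
          (by rw [degree_eq_natDegree (hP n).1.ne_zero, degree_eq_natDegree (hp n).1.ne_zero,
            (hP n).2, (hp n).2]) (hP n).1.ne_zero
          (by rw [(hP n).1.leadingCoeff, (hp n).1.leadingCoeff]))
        rwa [(hP n).2] at this
      -- With `d` the degree of `D` and `P d = p d` by induction, `D` is orthogonal to `p d`. But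
      -- `⟨p d, D⟩` is `2^{-d}` times an invertible moment times the adjoint of the leading
      -- coefficient of `D`, which must therefore vanish.
      set D := P n - p n with hD
      have h1 : weightInner N D (p D.natDegree) = 0 := by
        rw [hD, weightInner_sub_left, ← hD, ← ih _ hdeg, hPo n _ hdeg.ne', ih _ hdeg,
          weightInner_eq_zero_of_natDegree_lt (h0 n) (by rwa [(hp _).2]), sub_zero]
      have h2 : weightInner N (p D.natDegree) D = 0 := by
        rw [← weightInner_conjTranspose, h1, Matrix.conjTranspose_zero]
      rw [weightInner_eq_of_natDegree_eq (h0 _) rfl, smul_mul_assoc,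
        smul_eq_zero_iff_right (inv_ne_zero (pow_ne_zero _ two_ne_zero)), (hu _).mul_right_eq_zero,
        Matrix.conjTranspose_eq_zero, leadingCoeff_eq_zero] at h2
      exact hd0 h2
  · rintro rfl
    refine ⟨hp, fun n m hnm => ?_⟩
    rcases lt_or_gt_of_ne hnm with h | h
    · rw [← weightInner_conjTranspose,
        weightInner_eq_zero_of_natDegree_lt (h0 m) (by rwa [(hp n).2]), Matrix.conjTranspose_zero]
    · exact weightInner_eq_zero_of_natDegree_lt (h0 n) (by rwa [(hp m).2])

end MatrixPolynomial

/-! ### The three-term recurrence and the closed form of the moments -/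

/-- The tridiagonal coefficient in the three-term recurrence of the monic orthogonal polynomials. -/
def recurrenceB (N n : ℕ) : Matrix (Fin (N + 1)) (Fin (N + 1)) ℂ :=
  Matrix.of fun i l =>
    if (l : ℕ) + 1 = i then
      (((i : ℝ) ^ 2 / (2 * (n + i) * (n + i + 1)) : ℝ) : ℂ)
    else if (l : ℕ) = i + 1 then
      ((((N : ℝ) - i) ^ 2 / (2 * (N - i + n) * (N - i + n + 1)) : ℝ) : ℂ)
    else 0

/-- The diagonal coefficient in the three-term recurrence, shifted by one: it multiplies the
polynomial of degree `n` in the expression for the one of degree `n + 2`. -/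
def recurrenceC (N n : ℕ) : Matrix (Fin (N + 1)) (Fin (N + 1)) ℂ :=
  Matrix.diagonal fun i =>
    ((((n : ℝ) + 1) ^ 2 * (N + n + 2) ^ 2 /
      (4 * (n + 1 + i) * (n + i + 2) * (N - i + n + 1) * (N - i + n + 2)) : ℝ) : ℂ)

/-- The monic orthogonal polynomials, defined by their three-term recurrence. -/
def monicOrthogonal (N : ℕ) : ℕ → (Matrix (Fin (N + 1)) (Fin (N + 1)) ℂ)[X]
  | 0 => 1
  | 1 => (X - C (recurrenceB N 0)) * 1
  | n + 2 => (X - C (recurrenceB N (n + 1))) * monicOrthogonal N (n + 1)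
      - C (recurrenceC N n) * monicOrthogonal N n

theorem monicOrthogonal_monic (N : ℕ) (n : ℕ) :
    (monicOrthogonal N n).Monic ∧ (monicOrthogonal N n).natDegree = n := by
  induction n using Nat.twoStepInduction with
  | zero => simp [monicOrthogonal]
  | one => simp [monicOrthogonal, monic_X_sub_C]
  | more n ih1 ih2 =>
    have hm := (monic_X_sub_C (recurrenceB N (n + 1))).mul ih2.1
    have hd : ((X - C (recurrenceB N (n + 1))) * monicOrthogonal N (n + 1)).natDegree = n + 2 := by
      rw [(monic_X_sub_C _).natDegree_mul ih2.1, natDegree_X_sub_C, ih2.2]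
      ring
    have hlt : (C (recurrenceC N n) * monicOrthogonal N n).natDegree < n + 2 :=
      (natDegree_C_mul_le _ _).trans_lt (by rw [ih1.2]; omega)
    rw [monicOrthogonal]
    refine ⟨hm.sub_of_left ?_, ?_⟩
    · exact degree_lt_degree (by rwa [hd])
    · rw [natDegree_sub_eq_left_of_natDegree_lt (by rwa [hd]), hd]

/-- The row-dependent normalisation of the Chebyshev moments. -/
def rowFactor (N n i : ℕ) : ℝ :=
  ((2 : ℝ) ^ n)⁻¹ * (((N + n + 1).factorial : ℝ) / (N.factorial : ℝ)) ^ 2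
    * ((i.factorial : ℝ) ^ 2 * ((N - i).factorial : ℝ) ^ 2)
    / (((n + i).factorial : ℝ) * ((N - i + n).factorial : ℝ))

theorem rowFactor_zero {N i : ℕ} :
    rowFactor N 0 i = ((N : ℝ) + 1) ^ 2 * (i.factorial * (N - i).factorial) := by
  rw [rowFactor, add_zero, Nat.factorial_succ]
  have f1 : (N.factorial : ℝ) ≠ 0 := by exact_mod_cast Nat.factorial_ne_zero _
  have f2 : (i.factorial : ℝ) ≠ 0 := by exact_mod_cast Nat.factorial_ne_zero _
  have f3 : ((N - i).factorial : ℝ) ≠ 0 := by exact_mod_cast Nat.factorial_ne_zero _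
  simp only [zero_add, add_zero]
  push_cast
  field_simp

theorem cast_factorial_succ (m : ℕ) :
    (((m + 1).factorial : ℕ) : ℝ) = (m + 1) * (m.factorial : ℝ) := by
  rw [Nat.factorial_succ]; push_cast; ring

theorem rowFactor_succ (N n i : ℕ) (hi : i ≤ N) :
    2 * ((n : ℝ) + i + 1) * (N - i + n + 1) * rowFactor N (n + 1) i
      = ((N : ℝ) + n + 2) ^ 2 * rowFactor N n i := by
  obtain ⟨m, rfl⟩ := Nat.exists_eq_add_of_le hi
  have e1 := cast_factorial_succ (i + m + n + 1)
  have e2 := cast_factorial_succ (n + i)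
  have e3 := cast_factorial_succ (m + n)
  rw [show i + m + n + 1 + 1 = i + m + (n + 1) + 1 by ring] at e1
  rw [show n + i + 1 = n + 1 + i by ring] at e2
  rw [show m + n + 1 = m + (n + 1) by ring] at e3
  simp only [rowFactor, Nat.add_sub_cancel_left]
  rw [e1, e2, e3]
  have f1 : ((n + i).factorial : ℝ) ≠ 0 := by exact_mod_cast Nat.factorial_ne_zero _
  have f2 : ((m + n).factorial : ℝ) ≠ 0 := by exact_mod_cast Nat.factorial_ne_zero _
  have f3 : ((i + m).factorial : ℝ) ≠ 0 := by exact_mod_cast Nat.factorial_ne_zero _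
  have f4 : (n : ℝ) + i + 1 ≠ 0 := by positivity
  have f5 : (m : ℝ) + n + 1 ≠ 0 := by positivity
  push_cast
  field_simp
  ring

/-- Ratio of neighbouring rows. Conjugating `recurrenceB` by the row factors gives both
off-diagonals the common denominator `2 (n + i + 1) (N - i + n + 1)`. -/
theorem rowFactor_lower (N n i : ℕ) (hi : i + 1 ≤ N) :
    ((i : ℝ) + 1) ^ 2 * (N - (i + 1) + n + 1) * rowFactor N n i
      = ((N : ℝ) - i) ^ 2 * (n + (i + 1)) * rowFactor N n (i + 1) := by
  obtain ⟨m, rfl⟩ := Nat.exists_eq_add_of_le hi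
  have e1 := cast_factorial_succ m
  have e2 := cast_factorial_succ i
  have e3 := cast_factorial_succ (n + i)
  have e4 := cast_factorial_succ (m + n)
  rw [show m + n + 1 = m + 1 + n by ring] at e4
  rw [add_assoc] at e3
  simp only [rowFactor, Nat.add_sub_cancel_left]
  rw [show i + 1 + m - i = m + 1 by omega, e1, e2, e3, e4]
  have f1 : ((n + i).factorial : ℝ) ≠ 0 := by exact_mod_cast Nat.factorial_ne_zero _
  have f2 : ((m + n).factorial : ℝ) ≠ 0 := by exact_mod_cast Nat.factorial_ne_zero _
  have f3 : ((i + 1 + m).factorial : ℝ) ≠ 0 := by exact_mod_cast Nat.factorial_ne_zero _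
  have f4 : (n : ℝ) + i + 1 ≠ 0 := by positivity
  have f5 : (m : ℝ) + n + 1 ≠ 0 := by positivity
  push_cast
  field_simp
  ring

/-- Multiplication by the tridiagonal recurrence coefficient on a column of the form
`rowFactor · s` where `s` vanishes outside the range of the rows. -/
theorem sum_recurrenceB_mul (N n : ℕ) (i : Fin (N + 1)) (s : ℤ → ℝ) (h0 : s (-1) = 0)
    (hN : s (N + 1) = 0) :
    ∑ l : Fin (N + 1), recurrenceB N n i l * ((rowFactor N n l * s (l : ℕ) : ℝ) : ℂ)
      = ((rowFactor N n i * (((N : ℝ) - i + 1) ^ 2 * s ((i : ℕ) - 1)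
          + ((i : ℝ) + 1) ^ 2 * s ((i : ℕ) + 1))
          / (2 * (n + i + 1) * (N - i + n + 1)) : ℝ) : ℂ) := by
  obtain ⟨i, hi⟩ := i
  have hiN : (0 : ℝ) ≤ (N : ℝ) - i := by
    have : (i : ℝ) ≤ N := by exact_mod_cast Nat.lt_succ_iff.mp hi
    linarith
  have hlow : ∑ l : Fin (N + 1), (if (l : ℕ) + 1 = i then
        (((i : ℝ) ^ 2 / (2 * (n + i) * (n + i + 1)) : ℝ) : ℂ) else 0)
          * ((rowFactor N n l * s (l : ℕ) : ℝ) : ℂ)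
      = ((rowFactor N n i * (((N : ℝ) - i + 1) ^ 2 * s ((i : ℕ) - 1))
          / (2 * (n + i + 1) * (N - i + n + 1)) : ℝ) : ℂ) := by
    rcases i with _ | i
    · simp [h0]
    · rw [Finset.sum_eq_single ⟨i, by omega⟩]
      · simp only [if_true]
        rw [← Complex.ofReal_mul]
        congr 1
        have h := rowFactor_lower N n i (by omega)
        push_cast at hiN ⊢
        rw [show (i : ℤ) + 1 - 1 = i by ring]
        have f1 : (n : ℝ) + (i + 1) ≠ 0 := by positivity
        have f2 : (n : ℝ) + (i + 1) + 1 ≠ 0 := by positivity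
        have f3 : (N : ℝ) - (i + 1) + n + 1 ≠ 0 := by positivity
        rw [div_mul_eq_mul_div, div_eq_div_iff (by positivity) (by positivity)]
        linear_combination 2 * (n + (i + 1) + 1) * s i * h
      · intro l _ hl
        rw [if_neg, zero_mul]
        intro h
        exact hl (Fin.ext (by simpa using h))
      · simp
  have hup : ∑ l : Fin (N + 1), (if (l : ℕ) = i + 1 then
        ((((N : ℝ) - i) ^ 2 / (2 * (N - i + n) * (N - i + n + 1)) : ℝ) : ℂ) else 0)
          * ((rowFactor N n l * s (l : ℕ) : ℝ) : ℂ)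
      = ((rowFactor N n i * (((i : ℝ) + 1) ^ 2 * s ((i : ℕ) + 1))
          / (2 * (n + i + 1) * (N - i + n + 1)) : ℝ) : ℂ) := by
    rcases (Nat.lt_succ_iff.mp hi).eq_or_lt with rfl | hlt
    · rw [hN, Finset.sum_eq_zero]
      · simp
      · intro l _
        rw [if_neg (by omega), zero_mul]
    · rw [Finset.sum_eq_single ⟨i + 1, by omega⟩]
      · simp only [if_true]
        rw [← Complex.ofReal_mul]
        congr 1
        have h := rowFactor_lower N n i hlt
        have hlt' : (0 : ℝ) < (N : ℝ) - i := by
          have : (i : ℝ) < N := by exact_mod_cast hlt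
          linarith
        push_cast
        rw [div_mul_eq_mul_div, div_eq_div_iff (by positivity) (by positivity)]
        linear_combination -2 * (N - i + n + 1) * s (i + 1) * h
      · intro l _ hl
        rw [if_neg, zero_mul]
        intro h
        exact hl (Fin.ext (by simpa using h))
      · simp
  rw [mul_add, add_div, Complex.ofReal_add, ← hlow, ← hup, ← Finset.sum_add_distrib]
  refine Finset.sum_congr rfl fun l _ => ?_
  rw [← add_mul]
  congr 1
  simp only [recurrenceB, Matrix.of_apply]
  split_ifs with h1 h2
  · omega
  · simp
  · simp
  · simp

/-- The Chebyshev moments of the monic orthogonal polynomials. -/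
theorem chebyshevMoment_monicOrthogonal (N n : ℕ) :
    ∀ k : ℤ, -1 ≤ k → ∀ i j : Fin (N + 1), chebyshevMoment k (monicOrthogonal N n) i j
      = ((Real.pi / 2 * ((j : ℕ).factorial * (N - j).factorial) *
          (rowFactor N n i * stretchedCoeff N n (i : ℕ) (j : ℕ) k) : ℝ) : ℂ) := by
  -- The index `k = -1` is included because the step at `k = 0` refers to it. Both sides vanish
  -- there.
  have hneg (n : ℕ) (i j : Fin (N + 1)) : chebyshevMoment (-1) (monicOrthogonal N n) i j
      = ((Real.pi / 2 * ((j : ℕ).factorial * (N - j).factorial) *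
          (rowFactor N n i * stretchedCoeff N n (i : ℕ) (j : ℕ) (-1)) : ℝ) : ℂ) := by
    rw [chebyshevMoment_neg_one, stretchedCoeff_of_lt N n (by omega)]
    simp
  have hB (n : ℕ) (k : ℤ) (i j : Fin (N + 1))
      (h : ∀ i j : Fin (N + 1), chebyshevMoment k (monicOrthogonal N n) i j
        = ((Real.pi / 2 * ((j : ℕ).factorial * (N - j).factorial) *
          (rowFactor N n i * stretchedCoeff N n (i : ℕ) (j : ℕ) k) : ℝ) : ℂ)) :
      (recurrenceB N n * chebyshevMoment k (monicOrthogonal N n)) i j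
        = ((Real.pi / 2 * ((j : ℕ).factorial * (N - j).factorial) *
          (rowFactor N n i * (((N : ℝ) - i + 1) ^ 2 * stretchedCoeff N n ((i : ℕ) - 1) (j : ℕ) k
          + ((i : ℝ) + 1) ^ 2 * stretchedCoeff N n ((i : ℕ) + 1) (j : ℕ) k)
          / (2 * (n + i + 1) * (N - i + n + 1))) : ℝ) : ℂ) := by
    rw [Complex.ofReal_mul, ← sum_recurrenceB_mul N n i (fun l => stretchedCoeff N n l (j : ℕ) k)
      (stretchedCoeff_of_row_neg N n (by omega)) (stretchedCoeff_of_row_gt N n (by omega)),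
      Matrix.mul_apply, Finset.mul_sum]
    refine Finset.sum_congr rfl fun l _ => ?_
    rw [h, Complex.ofReal_mul]
    ring
  have h0 : ∀ k : ℤ, -1 ≤ k → ∀ i j : Fin (N + 1), chebyshevMoment k (monicOrthogonal N 0) i j
      = ((Real.pi / 2 * ((j : ℕ).factorial * (N - j).factorial) *
        (rowFactor N 0 i * stretchedCoeff N 0 (i : ℕ) (j : ℕ) k) : ℝ) : ℂ) := by
    intro k hk i j
    rcases hk.eq_or_lt with rfl | hk
    · exact hneg 0 i j
    · simp only [chebyshevMoment, Matrix.of_apply, monicOrthogonal, matEval_one, one_mul]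
      rw [integral_U_mul_weight N i j (by omega), rowFactor_zero]
      congr 1
      ring
  induction n using Nat.twoStepInduction with
  | zero => exact h0
  | one =>
    intro k hk i j
    rcases hk.eq_or_lt with rfl | hk
    · exact hneg 1 i j
    have hrec : monicOrthogonal N 1
        = X * monicOrthogonal N 0 - C (recurrenceB N 0) * monicOrthogonal N 0 := by
      simp [monicOrthogonal]
    rw [hrec, chebyshevMoment_sub, chebyshevMoment_X_mul, chebyshevMoment_C_mul,
      Matrix.sub_apply, hB 0 k i j (h0 k hk.le), Matrix.smul_apply, Matrix.add_apply,
      h0 _ (by omega), h0 _ (by omega), smul_eq_mul, ← Complex.ofReal_ofNat, ← Complex.ofReal_inv,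
      ← Complex.ofReal_add, ← Complex.ofReal_mul, ← Complex.ofReal_sub]
    congr 1
    have hiN : (0 : ℝ) ≤ (N : ℝ) - (i : ℕ) := by
      have : ((i : ℕ) : ℝ) ≤ N := by exact_mod_cast Nat.lt_succ_iff.mp i.2
      linarith
    have r1 := rowFactor_succ N 0 i (by omega)
    have r2 := stretchedCoeff_recurrence_zero N (i : ℕ) (j : ℕ) (k := k) (by omega)
    push_cast at r1 r2 ⊢
    have r1' : rowFactor N 1 i
        = ((N : ℝ) + 2) ^ 2 * rowFactor N 0 i / (2 * (i + 1) * (N - i + 1)) := by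
      rw [eq_div_iff (by positivity)]
      linear_combination r1
    rw [r1']
    have f1 : ((i : ℕ) : ℝ) + 1 ≠ 0 := by positivity
    have f2 : (N : ℝ) - (i : ℕ) + 1 ≠ 0 := by positivity
    simp only [zero_add, add_zero]
    field_simp
    linear_combination rowFactor N 0 i * r2
  | more n ih1 ih2 =>
    intro k hk i j
    rcases hk.eq_or_lt with rfl | hk
    · exact hneg (n + 2) i j
    have hrec : monicOrthogonal N (n + 2)
        = X * monicOrthogonal N (n + 1) - C (recurrenceB N (n + 1)) * monicOrthogonal N (n + 1)
          - C (recurrenceC N n) * monicOrthogonal N n := by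
      rw [monicOrthogonal, sub_mul]
    rw [hrec, chebyshevMoment_sub, chebyshevMoment_sub, chebyshevMoment_X_mul,
      chebyshevMoment_C_mul, chebyshevMoment_C_mul,
      Matrix.sub_apply, Matrix.sub_apply, hB (n + 1) k i j (ih2 k hk.le), Matrix.smul_apply,
      Matrix.add_apply, ih2 _ (by omega), ih2 _ (by omega), recurrenceC, Matrix.diagonal_mul,
      ih1 k hk.le, smul_eq_mul, ← Complex.ofReal_ofNat,
      ← Complex.ofReal_inv, ← Complex.ofReal_add, ← Complex.ofReal_mul, ← Complex.ofReal_mul,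
      ← Complex.ofReal_sub, ← Complex.ofReal_sub]
    congr 1
    have hiN : (0 : ℝ) ≤ (N : ℝ) - (i : ℕ) := by
      have : ((i : ℕ) : ℝ) ≤ N := by exact_mod_cast Nat.lt_succ_iff.mp i.2
      linarith
    have r0 := rowFactor_succ N n i (by omega)
    have r1 := rowFactor_succ N (n + 1) i (by omega)
    have r2 := stretchedCoeff_recurrence N n (i : ℕ) (j : ℕ) k
    push_cast at r1 r2 ⊢
    -- Expressing all row factors through the one of degree `n + 1` leaves a multiple of `r2`.
    have r0' : rowFactor N n i
        = 2 * ((n : ℝ) + 1 + i) * (N - i + n + 1) * rowFactor N (n + 1) i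
          / ((N : ℝ) + n + 2) ^ 2 := by
      rw [eq_div_iff (by positivity)]
      linear_combination -r0
    have r1' : rowFactor N (n + 2) i
        = ((N : ℝ) + n + 3) ^ 2 * rowFactor N (n + 1) i
          / (2 * ((n : ℝ) + i + 2) * (N - i + n + 2)) := by
      rw [eq_div_iff (by positivity)]
      linear_combination r1
    rw [r0', r1', show (n : ℝ) + 1 + (i : ℕ) + 1 = n + (i : ℕ) + 2 by ring,
      show (N : ℝ) - (i : ℕ) + (n + 1) + 1 = N - (i : ℕ) + n + 2 by ring]
    rw [show (n : ℝ) + 1 + (i : ℕ) + 1 = n + (i : ℕ) + 2 by ring,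
      show (N : ℝ) - (i : ℕ) + (n + 1) + 1 = N - (i : ℕ) + n + 2 by ring] at r2
    have f1 : (n : ℝ) + (i : ℕ) + 2 ≠ 0 := by positivity
    have f2 : (N : ℝ) - (i : ℕ) + n + 2 ≠ 0 := by positivity
    have f3 : (n : ℝ) + 1 + (i : ℕ) ≠ 0 := by positivity
    have f4 : (N : ℝ) - (i : ℕ) + n + 1 ≠ 0 := by positivity
    have f5 : (N : ℝ) + n + 2 ≠ 0 := by positivity
    field_simp
    linear_combination 4 * rowFactor N (n + 1) i * r2

/-! ### Squared norms and flip symmetry -/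

theorem chebyshevMoment_monicOrthogonal_of_lt (N n k : ℕ) (h : k < n) :
    chebyshevMoment k (monicOrthogonal N n) = 0 := by
  ext i j
  rw [chebyshevMoment_monicOrthogonal N n k (by omega), stretchedCoeff_of_lt N n (by omega)]
  simp

theorem rowFactor_mul_eq_squaredNormEntry (N n i : ℕ) (hi : i ≤ N) :
    Real.pi / 2 * ((i : ℕ).factorial * (N - i).factorial) *
      (rowFactor N n i * ((n.factorial : ℝ) ^ 2 * (invFact i * invFact (N - i)
        * invFact (n + 1 + i) * invFact (N + n + 1 - i))))
    = 2 ^ n * squaredNormEntry N n i := by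
  obtain ⟨m, rfl⟩ := Nat.exists_eq_add_of_le hi
  have s1 := shiftedFactorial_natCast_add_one (i + m) (n + 1)
  have s2 := shiftedFactorial_natCast_add_one i n
  have s3 := shiftedFactorial_natCast_add_one m n
  have e1 := cast_factorial_succ (n + i)
  have e2 := cast_factorial_succ (m + n)
  rw [show n + i + 1 = n + 1 + i by ring] at e1
  rw [squaredNormEntry, s1, s2, show ((i + m : ℕ) : ℝ) - i + 1 = (m : ℝ) + 1 by push_cast; ring,
    s3, rowFactor, Nat.add_sub_cancel_left,
    show ((i + m : ℕ) : ℤ) - i = (m : ℕ) by push_cast; ring,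
    show (n : ℤ) + 1 + i = ((n + 1 + i : ℕ) : ℤ) by push_cast; ring,
    show ((i + m : ℕ) : ℤ) + n + 1 - i = ((m + n + 1 : ℕ) : ℤ) by push_cast; ring,
    invFact_natCast, invFact_natCast, invFact_natCast, invFact_natCast, e1, e2,
    add_comm i n, show i + m + (n + 1) = i + m + n + 1 by ring]
  have f1 : ((n + i).factorial : ℝ) ≠ 0 := by exact_mod_cast Nat.factorial_ne_zero _
  have f2 : ((m + n).factorial : ℝ) ≠ 0 := by exact_mod_cast Nat.factorial_ne_zero _
  have f3 : ((i + m).factorial : ℝ) ≠ 0 := by exact_mod_cast Nat.factorial_ne_zero _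
  have f4 : (i.factorial : ℝ) ≠ 0 := by exact_mod_cast Nat.factorial_ne_zero _
  have f5 : (m.factorial : ℝ) ≠ 0 := by exact_mod_cast Nat.factorial_ne_zero _
  have f6 : (n : ℝ) + i + 1 ≠ 0 := by positivity
  have f7 : (m : ℝ) + n + 1 ≠ 0 := by positivity
  push_cast
  rw [show (i : ℝ) + m - i + n + 1 = m + n + 1 by ring]
  field_simp
  ring

theorem chebyshevMoment_monicOrthogonal_self (N n : ℕ) :
    chebyshevMoment n (monicOrthogonal N n)
      = (2 : ℂ) ^ n • Matrix.diagonal fun i : Fin (N + 1) => ((squaredNormEntry N n i : ℝ) : ℂ) := by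
  ext i j
  rw [chebyshevMoment_monicOrthogonal N n n (by omega), stretchedCoeff_self, Matrix.smul_apply,
    Matrix.diagonal_apply]
  by_cases h : i = j
  · subst h
    rw [if_pos rfl, if_pos rfl, rowFactor_mul_eq_squaredNormEntry N n i (by omega)]
    push_cast
    rfl
  · rw [if_neg h, if_neg (by simpa [Fin.ext_iff] using h)]
    simp

theorem squaredNormEntry_pos (N n i : ℕ) (hi : i ≤ N) : 0 < squaredNormEntry N n i := by
  obtain ⟨m, rfl⟩ := Nat.exists_eq_add_of_le hi
  rw [squaredNormEntry, show ((i + m : ℕ) : ℝ) - i = m by push_cast; ring,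
    shiftedFactorial_natCast_add_one, shiftedFactorial_natCast_add_one,
    shiftedFactorial_natCast_add_one]
  have := Real.pi_pos
  positivity

theorem isUnit_chebyshevMoment_monicOrthogonal (N n : ℕ) :
    IsUnit (chebyshevMoment n (monicOrthogonal N n)) := by
  rw [chebyshevMoment_monicOrthogonal_self, Matrix.isUnit_iff_isUnit_det, Matrix.det_smul,
    Matrix.det_diagonal, isUnit_iff_ne_zero]
  refine mul_ne_zero (pow_ne_zero _ (pow_ne_zero _ two_ne_zero)) (Finset.prod_ne_zero_iff.mpr fun i _ => ?_)
  exact_mod_cast (squaredNormEntry_pos N n i (by omega)).ne'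

theorem weightInner_monicOrthogonal_self (N n : ℕ) :
    weightInner N (monicOrthogonal N n) (monicOrthogonal N n)
      = Matrix.diagonal fun i : Fin (N + 1) => ((squaredNormEntry N n i : ℝ) : ℂ) := by
  have hm := monicOrthogonal_monic N n
  rw [weightInner_eq_of_natDegree_eq (chebyshevMoment_monicOrthogonal_of_lt N n) hm.2,
    hm.1.leadingCoeff, Matrix.conjTranspose_one, mul_one, chebyshevMoment_monicOrthogonal_self,
    smul_smul, inv_mul_cancel₀ (pow_ne_zero _ two_ne_zero), one_smul]

/-- The map `i ↦ N - i` exchanges the paired factors in the denominators. -/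
theorem squaredNormEntry_rev (N n : ℕ) (i : Fin (N + 1)) :
    squaredNormEntry N n (Fin.rev i) = squaredNormEntry N n i := by
  have h : ((Fin.rev i : ℕ) : ℝ) = (N : ℝ) - (i : ℕ) := by
    rw [Fin.val_rev, Nat.cast_sub (by omega)]
    push_cast
    ring
  simp only [squaredNormEntry]
  rw [h, sub_sub_cancel]
  ring

/-- `J` is the permutation matrix of the involution `Fin.rev`. -/
theorem flipMatrix_mul_diagonal_mul_flipMatrix (N : ℕ) (d : Fin (N + 1) → ℂ) :
    flipMatrix N * Matrix.diagonal d * flipMatrix N = Matrix.diagonal fun i => d (Fin.rev i) := by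
  have h (i l : Fin (N + 1)) : flipMatrix N i l = if l = Fin.rev i then 1 else 0 := by
    simp only [flipMatrix, Matrix.of_apply, Fin.ext_iff, Fin.val_rev]
    congr 1
    apply propext
    omega
  ext i j
  rw [Matrix.mul_apply, Finset.sum_eq_single (Fin.rev i)]
  · simp [Matrix.mul_diagonal, h, Matrix.diagonal_apply, eq_comm]
  · intro l _ hl
    rw [Matrix.mul_diagonal, h i l, if_neg hl, zero_mul, zero_mul]
  · simp

end

/-- Here `N = 2ℓ` runs over all natural numbers. The weight `W` has a unique sequence of monic
orthogonal polynomials `P n`; its squared norm matrices `H n = ⟨P n, P n⟩_W` are diagonal with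
the stated entries, and they commute with the flip `J`. -/
theorem corollary5p4 (N : ℕ) :
    (∃! P : ℕ → Polynomial (Matrix (Fin (N + 1)) (Fin (N + 1)) ℂ), IsMonicOrthogonal N P) ∧
    ∀ P : ℕ → Polynomial (Matrix (Fin (N + 1)) (Fin (N + 1)) ℂ), IsMonicOrthogonal N P →
      ∀ n : ℕ,
        (∀ i j : Fin (N + 1),
          weightInner N (P n) (P n) i j =
            if i = j then ((squaredNormEntry N n i : ℝ) : ℂ) else 0) ∧
        flipMatrix N * weightInner N (P n) (P n) * flipMatrix N =
          weightInner N (P n) (P n) := by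
  have key := isMonicOrthogonal_iff_eq (monicOrthogonal_monic N)
    (chebyshevMoment_monicOrthogonal_of_lt N) (isUnit_chebyshevMoment_monicOrthogonal N)
  refine ⟨⟨monicOrthogonal N, (key _).mpr rfl, fun P hP => (key P).mp hP⟩, fun P hP n => ?_⟩
  rw [(key P).mp hP, weightInner_monicOrthogonal_self]
  refine ⟨fun i j => Matrix.diagonal_apply _ i j, ?_⟩
  simp only [flipMatrix_mul_diagonal_mul_flipMatrix, squaredNormEntry_rev]
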